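/- **Theorem (Leafwise approximation theorem).** Let $r\in\mathbb N\cup\{\infty\}$ and $s\in\mathbb N$ with $s<r$, and let $\mathcal F$ and $\mathcal F'$ be $C^r$ foliations on (Hausdorff, second countable) manifolds $M$ and $M'$, of codimensions $q,q'$ and dimensions $p,p'$. A foliation chart is a chart $\theta:U\to T\times B$ with $T\subset\mathbb R^q$ open and $B\subset\mathbb R^p$ convex open, changes of coordinates being locally of the form $(x,y)\mapsto(h(x),g(x,y))$; the composite $U\to T$ of $\theta$ with the first projection is its local projection, whose fibres are the plaques. The plaques form a base of the leaf topology, whose connected components are the leaves. A foliation map $\mathcal F\to\mathcal F'$ is a map $M\to M'$ that maps each leaf of $\mathcal F$ into a leaf of $\mathcal F'$; $C^k(\mathcal F,\mathcal F')$ is the set of those of class $C^k$. The strong plaquewise topology on $C^s(\mathcal F,\mathcal F')$ has as a base the sets of all $\psi\in C^s(\mathcal F,\mathcal F')$ such that, for all $i$ and all $x\in K_i$, $$\psi(x)\in U'_i,\qquad \pi'_i(\psi(x))=\pi'_i(\phi(x)),\qquad \bigl\|D^k(\theta'_i\psi\theta_i^{-1})(\theta_i(x))-D^k(\theta'_i\phi\theta_i^{-1})(\theta_i(x))\bigr\|<\epsilon_i\quad(0\le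 k\le s),$$ where $\phi\in C^s(\mathcal F,\mathcal F')$, $\{(U_i,\theta_i)\}$ is a locally finite family of foliation charts of $\mathcal F$, $\{(U'_i,\theta'_i)\}$ is a family of foliation charts of $\mathcal F'$ with local projections $\pi'_i$, the $K_i\subset U_i$ are compact with $\phi(K_i)\subset U'_i$, and $\epsilon_i>0$. Let $C^{r,s}(\mathcal F,\mathcal F')$ be the set of those $\phi\in C^s(\mathcal F,\mathcal F')$ such that, for all domains $U$, $U'$ of $C^r$ foliation charts of $\mathcal F$, $\mathcal F'$ with $\phi(U)\subset U'$, the composite of $\phi:U\to U'$ with the local projection of $U'$ is $C^r$; and let $C^{r,s}_{SP}(\mathcal F,\mathcal F')$ be this set with the restriction of the strong plaquewise topology of $C^s(\mathcal F,\mathcal F')$. Suppose that $\phi\in C^{r,s}(\mathcal F,\mathcal F')$ is $C^r$ on some neighbourhood of a closed subset $E\subset M$. Then every neighbourhood of $\phi$ in $C^{r,s}_{SP}(\mathcal F,\mathcal F')$ contains some $\psi\in C^r(\mathcal F,\mathcal F')$ which equals $\phi$ on some neighbourhood of $E$. In particular, $C^r(\mathcal F,\mathcal F')$ is dense in $C^{r,s}_{SP}(\mathcal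 F,\mathcal F')$. -/

import Mathlib

open Set Filter Topology
open scoped Manifold ContDiff

/-- The local model `ℝ^q × ℝ^p` of a foliation of codimension `q` and dimension `p`: the first factor
is the transverse direction and the second one is the leaf direction. -/
abbrev FolModel (q p : ℕ) : Type := EuclideanSpace ℝ (Fin q) × EuclideanSpace ℝ (Fin p)

/-- The maps between open subsets of `ℝ^q × ℝ^p` which are `C^k` and, around each point, of the form
`(x, y) ↦ (h x, g (x, y))`. -/
def foliationPregroupoid (k : ℕ∞) (q p : ℕ) : Pregroupoid (FolModel q p) where
  property f u := ContDiffOn ℝ k f u ∧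
    ∀ z ∈ u, ∃ v ∈ 𝓝 z, ∃ h : EuclideanSpace ℝ (Fin q) → EuclideanSpace ℝ (Fin q),
      ∀ a ∈ u ∩ v, (f a).1 = h a.1
  comp := by
    rintro f g u v ⟨hf, hf'⟩ ⟨hg, hg'⟩ hu - -
    refine ⟨hg.comp (hf.mono inter_subset_left) inter_subset_right, ?_⟩
    rintro z ⟨hzu, hzv⟩
    obtain ⟨w, hw, h, hh⟩ := hf' z hzu
    obtain ⟨w', hw', h', hh'⟩ := hg' (f z) hzv
    have hc : ContinuousAt f z := hf.continuousOn.continuousAt (hu.mem_nhds hzu)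
    refine ⟨w ∩ f ⁻¹' w', inter_mem hw (hc hw'), h' ∘ h, ?_⟩
    rintro a ⟨⟨hau, hav⟩, haw, haw'⟩
    simp only [Function.comp_apply]
    rw [hh' (f a) ⟨hav, haw'⟩, hh a ⟨hau, haw⟩]
  id_mem := ⟨contDiffOn_id, fun _ _ => ⟨univ, univ_mem, id, fun _ _ => rfl⟩⟩
  locality := by
    intro f u _ H
    constructor
    · intro z hz
      obtain ⟨v, hv, hzv, hf, -⟩ := H z hz
      exact (hf z ⟨hz, hzv⟩).mono_of_mem_nhdsWithin
        (inter_mem self_mem_nhdsWithin (mem_nhdsWithin_of_mem_nhds (hv.mem_nhds hzv)))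
    · intro z hz
      obtain ⟨v, hv, hzv, -, hf⟩ := H z hz
      obtain ⟨w, hw, h, hh⟩ := hf z ⟨hz, hzv⟩
      exact ⟨v ∩ w, inter_mem (hv.mem_nhds hzv) hw, h, fun a ha => hh a ⟨⟨ha.1, ha.2.1⟩, ha.2.2⟩⟩
  congr := by
    rintro f g u _ hgf ⟨hf, hf'⟩
    refine ⟨hf.congr hgf, fun z hz => ?_⟩
    obtain ⟨w, hw, h, hh⟩ := hf' z hz
    exact ⟨w, hw, h, fun a ha => by rw [hgf a ha.1]; exact hh a ha⟩

/-- The changes of coordinates of `C^k` foliations of codimension `q` and dimension `p`. A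
`C^k` foliation on `M` is a `ChartedSpace (FolModel q p) M` structure whose changes of coordinates
belong to this groupoid, that is, such that `HasGroupoid M (foliationGroupoid k q p)`. -/
def foliationGroupoid (k : ℕ∞) (q p : ℕ) : StructureGroupoid (FolModel q p) :=
  (foliationPregroupoid k q p).groupoid

/-- The changes of coordinates of a `C^k` foliation are `C^k`, so the ambient space of a `C^k`
foliation is a `C^k` manifold. -/
theorem foliationGroupoid_le_contDiffGroupoid (k : ℕ∞) (q p : ℕ) :
    foliationGroupoid k q p ≤ contDiffGroupoid k 𝓘(ℝ, FolModel q p) := by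
  refine groupoid_of_pregroupoid_le _ _ fun f u hf => ?_
  simpa [contDiffPregroupoid] using hf.1

section Foliation

variable {q p : ℕ} {M : Type*} [TopologicalSpace M] [ChartedSpace (FolModel q p) M]

/-- The foliation charts of class `C^k`: the charts of the maximal `C^k` foliation atlas whose image
is `T × B` with `T ⊆ ℝ^q` open and `B ⊆ ℝ^p` convex and open. The local projection of such a chart
`e` is `z ↦ (e z).1`. -/
def IsFoliationChart (k : ℕ∞) (e : OpenPartialHomeomorph M (FolModel q p)) : Prop :=
  e ∈ (foliationGroupoid k q p).maximalAtlas M ∧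
    ∃ (T : Set (EuclideanSpace ℝ (Fin q))) (B : Set (EuclideanSpace ℝ (Fin p))),
      IsOpen T ∧ IsOpen B ∧ Convex ℝ B ∧ e.target = T ×ˢ B

/-- The plaque of the chart `e` over the point `t` of the local quotient. -/
def plaque (e : OpenPartialHomeomorph M (FolModel q p)) (t : EuclideanSpace ℝ (Fin q)) : Set M :=
  {z ∈ e.source | (e z).1 = t}

variable (q p M) in
/-- The leaf topology, generated by the plaques of all (topological) foliation charts. -/
@[reducible]
def leafTopology : TopologicalSpace M :=
  TopologicalSpace.generateFrom
    {P | ∃ e : OpenPartialHomeomorph M (FolModel q p), IsFoliationChart 0 e ∧ ∃ t, P = plaque e t}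

variable (q p) in
/-- The leaf through `x`: its connected component in the leaf topology. -/
def leaf (x : M) : Set M :=
  @connectedComponent M (leafTopology q p M) x

end Foliation

section FoliationMaps

variable (q p q' p' : ℕ) (M M' : Type*) [TopologicalSpace M] [ChartedSpace (FolModel q p) M]
  [TopologicalSpace M'] [ChartedSpace (FolModel q' p') M']

/-- The set `C^k(𝓕, 𝓕')` of `C^k` foliation maps, for finite `k`: the `C^k` maps `M → M'` which map
each leaf of `𝓕` into a leaf of `𝓕'`. -/
structure FolMap (k : ℕ) where
  toFun : M → M'
  mapsTo_leaf : ∀ x, MapsTo toFun (leaf q p x) (leaf q' p' (toFun x))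
  contMDiff : ContMDiff 𝓘(ℝ, FolModel q p) 𝓘(ℝ, FolModel q' p') k toFun

variable {q p q' p' M M'}

/-- The set `𝓝^k(φ, Θ, Θ', 𝓚, 𝓔)` of the maps `ψ ∈ C^k(𝓕, 𝓕')` such that, for each `i` and each
`x ∈ K i`, the point `ψ x` is in the domain of `Θ' i`, in the same plaque of `Θ' i` as `φ x`, and the
derivatives up to order `k` of the local expressions of `φ` and `ψ` at `x` are `ε i`-close. -/
def spBasic {k : ℕ} (φ : FolMap q p q' p' M M' k) {ι : Type}
    (Θ : ι → OpenPartialHomeomorph M (FolModel q p))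
    (Θ' : ι → OpenPartialHomeomorph M' (FolModel q' p'))
    (K : ι → Set M) (ε : ι → ℝ) : Set (FolMap q p q' p' M M' k) :=
  {ψ | ∀ i, ∀ x ∈ K i,
    ψ.toFun x ∈ (Θ' i).source ∧
    (Θ' i (ψ.toFun x)).1 = (Θ' i (φ.toFun x)).1 ∧
    ∀ j ≤ k,
      ‖iteratedFDeriv ℝ j (Θ' i ∘ ψ.toFun ∘ (Θ i).symm) (Θ i x)
        - iteratedFDeriv ℝ j (Θ' i ∘ φ.toFun ∘ (Θ i).symm) (Θ i x)‖ < ε i}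

/-- The strong plaquewise topology of `C^k(𝓕, 𝓕')`, for finite `k`. -/
instance spTopology (k : ℕ) : TopologicalSpace (FolMap q p q' p' M M' k) :=
  TopologicalSpace.generateFrom
    {N | ∃ (φ : FolMap q p q' p' M M' k) (ι : Type)
        (Θ : ι → OpenPartialHomeomorph M (FolModel q p))
        (Θ' : ι → OpenPartialHomeomorph M' (FolModel q' p'))
        (K : ι → Set M) (ε : ι → ℝ),
      (∀ i, IsFoliationChart k (Θ i)) ∧
      LocallyFinite (fun i => (Θ i).source) ∧
      (∀ i, IsFoliationChart k (Θ' i)) ∧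
      (∀ i, IsCompact (K i) ∧ K i ⊆ (Θ i).source ∧ MapsTo φ.toFun (K i) (Θ' i).source) ∧
      (∀ i, 0 < ε i) ∧
      N = spBasic φ Θ Θ' K ε}

variable (q p q' p' M M') in
/-- The set `C^{r,s}(𝓕, 𝓕')` of the `C^s` foliation maps which are transversely `C^r`: whenever `φ`
maps the domain of a `C^r` foliation chart into the domain of another one, the composite of `φ` with
the local projection of the latter is `C^r`. -/
structure FolMapRS (r : ℕ∞) (s : ℕ) extends FolMap q p q' p' M M' s where
  transverse : ∀ (e : OpenPartialHomeomorph M (FolModel q p))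
    (e' : OpenPartialHomeomorph M' (FolModel q' p')),
    IsFoliationChart r e → IsFoliationChart r e' → MapsTo toFun e.source e'.source →
    ContMDiffOn 𝓘(ℝ, FolModel q p) 𝓘(ℝ, EuclideanSpace ℝ (Fin q')) r
      (fun x => (e' (toFun x)).1) e.source

/-- The space `C^{r,s}_{SP}(𝓕, 𝓕')`: the restriction of the sp-topology of `C^s(𝓕, 𝓕')`. -/
instance spTopologyRS (r : ℕ∞) (s : ℕ) : TopologicalSpace (FolMapRS q p q' p' M M' r s) :=
  TopologicalSpace.induced FolMapRS.toFolMap (spTopology s)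

end FoliationMaps

/-! In foliation charts the map reads `f = (f₁, f₂)`, and `f₁` is already `C^r` because `φ` is
transversely `C^r`; only the leaf component `f₂` needs smoothing. Take a bump `χ`, mollify `w = χ
f₂`, let `d n` be the mollification minus `w`, and replace `f₂` by `f₂ + χ d n`. The first
coordinate is untouched, so points move inside plaques, and the jets of order at most `s` move
little. Where `χ = 1` the new leaf component is `w + d n`, which is smooth. Elsewhere `d n` is as
regular as `f`, so points where the map was already `C^r` stay so. This is
`exists_leafwise_smoothing`.

These steps are carried out over a countable locally finite family of charts which covers the
complement of a neighbourhood where `φ` is `C^r` and stays away from a smaller neighbourhood of `E`.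
Each point sees finitely many effective steps, so the limit exists
(`LocallyFinite.exists_successive_modification`).

All that has to survive is encoded by a locally finite family of `PlaqueConstraint`s on compact
sets. A step has compact support, hence meets finitely many of them, and each one is stable under
small perturbations along plaques, so a single large `n` works. Besides the constraints that
describe the given neighbourhood, there is one for each chart of the cover: it keeps the
intermediate maps in the target chart and in the plaques of `φ`. Their transverse component is thus
still that of `φ`, and the limit still maps leaves into leaves. -/

section Jets

/-! ### Locally uniform convergence of jets -/

variable {E F G : Type*} [NormedAddCommGroup E] [NormedSpace ℝ E]
  [NormedAddCommGroup F] [NormedSpace ℝ F] [NormedAddCommGroup G] [NormedSpace ℝ G]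

/-- The `s`-jets of the maps `f t` converge, locally uniformly around `x`, to the `s`-jet of `f₀`
when `t` tends along `l`. -/
structure JetTendsto (s : ℕ) {T : Type*} (l : Filter T) (f : T → E → F) (f₀ : E → F) (x : E) :
    Prop where
  eventually_contDiffAt : ∀ᶠ a in l ×ˢ 𝓝 x, ContDiffAt ℝ s (f a.1) a.2
  contDiffAt : ContDiffAt ℝ s f₀ x
  tendsto : ∀ j ≤ s, Tendsto (fun a : T × E => iteratedFDeriv ℝ j (f a.1) a.2) (l ×ˢ 𝓝 x)
    (𝓝 (iteratedFDeriv ℝ j f₀ x))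

theorem ContDiffAt.continuousAt_iteratedFDeriv_of_le {s j : ℕ} {f : E → F} {x : E}
    (hf : ContDiffAt ℝ s f x) (hj : j ≤ s) : ContinuousAt (iteratedFDeriv ℝ j f) x :=
  (hf.iteratedFDeriv_right (m := 0) (i := j) (by rw [zero_add]; exact_mod_cast hj)).continuousAt

namespace JetTendsto

variable {T : Type*} {l : Filter T} {s : ℕ}

theorem const {f : E → F} {x : E} (hf : ContDiffAt ℝ s f x) :
    JetTendsto s l (fun _ => f) f x where
  eventually_contDiffAt := tendsto_snd.eventually (hf.eventually (by simp))
  contDiffAt := hf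
  tendsto j hj := (hf.continuousAt_iteratedFDeriv_of_le hj).tendsto.comp tendsto_snd

theorem congr {f f' : T → E → F} {f₀ f₀' : E → F} {x : E} {O : Set E} (h : JetTendsto s l f f₀ x)
    (hO : O ∈ 𝓝 x) (hf : ∀ t, EqOn (f' t) (f t) O) (hf₀ : EqOn f₀' f₀ O) :
    JetTendsto s l f' f₀' x := by
  have hev : ∀ᶠ a : T × E in l ×ˢ 𝓝 x, f' a.1 =ᶠ[𝓝 a.2] f a.1 :=
    (tendsto_snd.eventually (eventually_mem_nhds_iff.2 hO)).mono
      fun a ha => (hf a.1).eventuallyEq_of_mem ha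
  have hev₀ : f₀' =ᶠ[𝓝 x] f₀ := hf₀.eventuallyEq_of_mem hO
  refine ⟨?_, h.contDiffAt.congr_of_eventuallyEq hev₀, fun j hj => ?_⟩
  · filter_upwards [hev, h.eventually_contDiffAt] with a h₁ h₂ using h₂.congr_of_eventuallyEq h₁
  · rw [(hev₀.iteratedFDeriv ℝ j).eq_of_nhds]
    refine (h.tendsto j hj).congr' ?_
    filter_upwards [hev] with a ha using ((ha.iteratedFDeriv ℝ j).eq_of_nhds).symm

theorem tendsto_apply {f : T → E → F} {f₀ : E → F} {x : E} (h : JetTendsto s l f f₀ x) :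
    Tendsto (fun a : T × E => f a.1 a.2) (l ×ˢ 𝓝 x) (𝓝 (f₀ x)) := by
  have := ((continuousMultilinearCurryFin0 ℝ E F).continuous.tendsto _).comp
    (h.tendsto 0 (Nat.zero_le _))
  simpa [Function.comp_def, iteratedFDeriv_zero_eq_comp] using this

/-- By the Faà di Bruno formula, each derivative of a composite is a finite sum of continuous
multilinear expressions in the derivatives of the two maps, so limits can be taken term by term.
Letting the base point vary in the convergence is what allows `g t` to be evaluated at the moving
point `f t y`. -/
theorem comp {g : T → F → G} {g₀ : F → G} {f : T → E → F} {f₀ : E → F} {x : E}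
    (hg : JetTendsto s l g g₀ (f₀ x)) (hf : JetTendsto s l f f₀ x) :
    JetTendsto s l (fun t => g t ∘ f t) (g₀ ∘ f₀) x := by
  have hpair : Tendsto (fun a : T × E => (a.1, f a.1 a.2)) (l ×ˢ 𝓝 x) (l ×ˢ 𝓝 (f₀ x)) :=
    tendsto_fst.prodMk hf.tendsto_apply
  have hgc := hpair.eventually hg.eventually_contDiffAt
  refine ⟨?_, hg.contDiffAt.comp x hf.contDiffAt, fun j hj => ?_⟩
  · filter_upwards [hgc, hf.eventually_contDiffAt] with a h₁ h₂ using h₁.comp _ h₂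
  rw [iteratedFDeriv_comp hg.contDiffAt hf.contDiffAt (by exact_mod_cast hj)]
  have hEq : (fun a : T × E => iteratedFDeriv ℝ j (g a.1 ∘ f a.1) a.2) =ᶠ[l ×ˢ 𝓝 x]
      fun a => (ftaylorSeries ℝ (g a.1) (f a.1 a.2)).taylorComp
        (ftaylorSeries ℝ (f a.1) a.2) j := by
    filter_upwards [hgc, hf.eventually_contDiffAt] with a h₁ h₂
    exact iteratedFDeriv_comp h₁ h₂ (by exact_mod_cast hj)
  refine Tendsto.congr' hEq.symm ?_
  simp only [FormalMultilinearSeries.taylorComp]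
  refine tendsto_finsetSum _ fun c _ => ?_
  let B := c.compAlongOrderedFinpartitionL ℝ E F G
  have hB : Continuous fun a : (F [×c.length]→L[ℝ] G) × (∀ i, E [×c.partSize i]→L[ℝ] F) =>
      B a.1 a.2 := by
    rw [← continuousOn_univ]
    exact B.analyticOnNhd_uncurry_of_multilinear.continuousOn
  refine (hB.tendsto (_, _)).comp (Tendsto.prodMk_nhds ?_ (tendsto_pi_nhds.2 fun i => ?_))
  · exact (hg.tendsto _ (c.length_le.trans hj)).comp hpair
  · exact hf.tendsto _ ((c.partSize_le i).trans hj)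

theorem prodMk {g : T → E → G} {g₀ : E → G} {f : T → E → F} {f₀ : E → F} {x : E}
    (hf : JetTendsto s l f f₀ x) (hg : JetTendsto s l g g₀ x) :
    JetTendsto s l (fun t y => (f t y, g t y)) (fun y => (f₀ y, g₀ y)) x := by
  refine ⟨?_, hf.contDiffAt.prodMk hg.contDiffAt, fun j hj => ?_⟩
  · filter_upwards [hf.eventually_contDiffAt, hg.eventually_contDiffAt] with a h₁ h₂
      using h₁.prodMk h₂
  have hj' : (j : ℕ∞ω) ≤ (s : ℕ∞ω) := by exact_mod_cast hj
  rw [iteratedFDeriv_prodMk hf.contDiffAt hg.contDiffAt hj']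
  have hEq : (fun a : T × E => iteratedFDeriv ℝ j (fun y => (f a.1 y, g a.1 y)) a.2)
      =ᶠ[l ×ˢ 𝓝 x] fun a => (iteratedFDeriv ℝ j (f a.1) a.2).prod
        (iteratedFDeriv ℝ j (g a.1) a.2) := by
    filter_upwards [hf.eventually_contDiffAt, hg.eventually_contDiffAt] with a h₁ h₂
    exact iteratedFDeriv_prodMk h₁ h₂ hj'
  refine Tendsto.congr' hEq.symm ?_
  exact ((ContinuousMultilinearMap.prodL ℝ _ _ _).continuous.tendsto (_, _)).comp
    ((hf.tendsto j hj).prodMk_nhds (hg.tendsto j hj))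

theorem of_fderiv {f : T → E → F} {f₀ : E → F} {x : E}
    (hc : ∀ t, ContDiff ℝ (s + 1 : ℕ) (f t)) (hc₀ : ContDiff ℝ (s + 1 : ℕ) f₀)
    (h0 : Tendsto (fun a : T × E => f a.1 a.2) (l ×ˢ 𝓝 x) (𝓝 (f₀ x)))
    (h : JetTendsto s l (fun t => fderiv ℝ (f t)) (fderiv ℝ f₀) x) :
    JetTendsto (s + 1) l f f₀ x := by
  refine ⟨.of_forall fun a => (hc a.1).contDiffAt, hc₀.contDiffAt, ?_⟩
  rintro (_ | j) hj
  · simp only [iteratedFDeriv_zero_eq_comp]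
    exact ((continuousMultilinearCurryFin0 ℝ E F).symm.continuous.tendsto _).comp h0
  · simp only [iteratedFDeriv_succ_eq_comp_right]
    exact ((continuousMultilinearCurryRightEquiv' ℝ j E F).symm.continuous.tendsto _).comp
      (h.tendsto j (by omega))

end JetTendsto

end Jets

/-! ### Smoothing by convolution -/

section Mollification

open MeasureTheory ContinuousLinearMap
open scoped Convolution

universe u

variable {E : Type u} [NormedAddCommGroup E] [NormedSpace ℝ E] [FiniteDimensional ℝ E]

section Convolution

variable [MeasurableSpace E] [BorelSpace E] {μ : Measure E} [μ.IsAddHaarMeasure]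

theorem ContDiffBump.contDiff_normed_convolution {F : Type*} [NormedAddCommGroup F]
    [NormedSpace ℝ F] (φ : ContDiffBump (0 : E)) {w : E → F} (hw : Continuous w) :
    ContDiff ℝ ∞ (φ.normed μ ⋆[lsmul ℝ ℝ, μ] w) :=
  φ.hasCompactSupport_normed.contDiff_convolution_left _ φ.contDiff_normed hw.locallyIntegrable

theorem ContDiffBump.fderiv_normed_convolution {F : Type*} [NormedAddCommGroup F]
    [NormedSpace ℝ F] (φ : ContDiffBump (0 : E)) {w : E → F} (hw : ContDiff ℝ 1 w)
    (hc : HasCompactSupport w) :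
    fderiv ℝ (φ.normed μ ⋆[lsmul ℝ ℝ, μ] w) = φ.normed μ ⋆[lsmul ℝ ℝ, μ] fderiv ℝ w := by
  ext1 x
  rw [(hc.hasFDerivAt_convolution_right (lsmul ℝ ℝ)
    φ.continuous_normed.locallyIntegrable hw x).fderiv]
  rfl

/-- Convolution commutes with `fderiv` on compactly supported `C^1` maps, so convergence of the
values, which needs only continuity, propagates to all derivatives by induction on `s`. -/
theorem JetTendsto.normed_convolution {T : Type*} {l : Filter T} {φ : T → ContDiffBump (0 : E)}
    (hφ : Tendsto (fun t => (φ t).rOut) l (𝓝 0)) {s : ℕ} {F : Type u} [NormedAddCommGroup F]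
    [NormedSpace ℝ F] [CompleteSpace F] {w : E → F} (hw : ContDiff ℝ s w)
    (hc : HasCompactSupport w) (x : E) :
    JetTendsto s l (fun t => (φ t).normed μ ⋆[lsmul ℝ ℝ, μ] w) w x := by
  have h0 : ∀ {F : Type u} [NormedAddCommGroup F] [NormedSpace ℝ F] [CompleteSpace F] {w : E → F},
      Continuous w → Tendsto (fun a : T × E => ((φ a.1).normed μ ⋆[lsmul ℝ ℝ, μ] w) a.2)
        (l ×ˢ 𝓝 x) (𝓝 (w x)) := fun {F} _ _ _ {w} hw =>
    ContDiffBump.convolution_tendsto_right (φ := fun a : T × E => φ a.1) (g := fun _ => w)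
      (k := fun a : T × E => a.2) (hφ.comp tendsto_fst)
      (.of_forall fun _ => hw.aestronglyMeasurable)
      ((hw.tendsto x).comp tendsto_snd) tendsto_snd
  -- The induction hypothesis is applied to `fderiv ℝ w`, with values in `E →L[ℝ] F`; sharing the
  -- universe `u` between `E` and `F` keeps this space in the range of the generalization.
  induction s generalizing F with
  | zero =>
    refine ⟨.of_forall fun a => ?_, hw.contDiffAt, fun j hj => ?_⟩
    · exact (((φ a.1).contDiff_normed_convolution hw.continuous).of_le
        (by exact_mod_cast le_top)).contDiffAt
    · obtain rfl : j = 0 := by omega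
      simp only [iteratedFDeriv_zero_eq_comp]
      exact ((continuousMultilinearCurryFin0 ℝ E F).symm.continuous.tendsto _).comp
        (h0 hw.continuous)
  | succ s ih =>
    have h1 : ContDiff ℝ 1 w := hw.of_le (by exact_mod_cast Nat.le_add_left 1 s)
    refine .of_fderiv (fun t => ((φ t).contDiff_normed_convolution hw.continuous).of_le
      (by exact_mod_cast le_top)) hw (h0 hw.continuous) ?_
    simp only [ContDiffBump.fderiv_normed_convolution _ h1 hc]
    exact ih (hw.fderiv_right (by norm_cast)) (hc.fderiv ℝ)

end Convolution

/-- A compactly supported `C^s` map is a limit of smooth maps, locally uniformly with its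
derivatives of order at most `s`. -/
theorem exists_contDiff_add_jetTendsto_zero {s : ℕ} {F : Type u} [NormedAddCommGroup F]
    [NormedSpace ℝ F] [CompleteSpace F] {w : E → F} (hw : ContDiff ℝ s w)
    (hc : HasCompactSupport w) :
    ∃ d : ℕ → E → F, (∀ n, ContDiff ℝ ∞ (fun z => w z + d n z)) ∧
      ∀ x, JetTendsto s atTop d (fun _ => 0) x := by
  borelize E
  let μ : Measure E := Measure.addHaar
  let φ : ℕ → ContDiffBump (0 : E) := fun n =>
    ⟨1 / (n + 2), 1 / (n + 1), by positivity, by gcongr; norm_num⟩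
  have hφ : Tendsto (fun n => (φ n).rOut) atTop (𝓝 0) := tendsto_one_div_add_atTop_nhds_zero_nat
  refine ⟨fun n z => ((φ n).normed μ ⋆[lsmul ℝ ℝ, μ] w) z - w z, fun n => ?_, fun x => ?_⟩
  · simpa using (φ n).contDiff_normed_convolution (μ := μ) hw.continuous
  · have h := JetTendsto.comp (f₀ := fun y => (w y, w y)) (.const (l := atTop) (s := s)
      (contDiff_fst.sub contDiff_snd : ContDiff ℝ s fun a : F × F => a.1 - a.2).contDiffAt)
      ((JetTendsto.normed_convolution (μ := μ) hφ hw hc x).prodMk (.const hw.contDiffAt))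
    simpa [Function.comp_def] using h

end Mollification

/-! ### Foliation charts, plaques and leaves -/

section FoliationCharts

theorem foliationGroupoid_anti (q p : ℕ) {k k' : ℕ∞} (h : k ≤ k') :
    foliationGroupoid k' q p ≤ foliationGroupoid k q p :=
  groupoid_of_pregroupoid_le _ _ fun _ _ hf => ⟨hf.1.of_le (by exact_mod_cast h), hf.2⟩

instance closedUnderRestriction_foliationGroupoid (k : ℕ∞) (q p : ℕ) :
    ClosedUnderRestriction (foliationGroupoid k q p) where
  closedUnderRestriction := by
    have hmono : ∀ {f : FolModel q p → FolModel q p} {u v : Set (FolModel q p)}, v ⊆ u →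
        (foliationPregroupoid k q p).property f u → (foliationPregroupoid k q p).property f v := by
      rintro f u v hvu ⟨h₁, h₂⟩
      refine ⟨h₁.mono hvu, fun z hz => ?_⟩
      obtain ⟨w, hw, h, hh⟩ := h₂ z (hvu hz)
      exact ⟨w, hw, h, fun a ha => hh a ⟨hvu ha.1, ha.2⟩⟩
    intro e he s _
    obtain ⟨h₁, h₂⟩ := mem_groupoid_of_pregroupoid.1 he
    exact mem_groupoid_of_pregroupoid.2 ⟨hmono (by simp) h₁, hmono (by simp) h₂⟩

variable {q p : ℕ} {M : Type*} [TopologicalSpace M] [ChartedSpace (FolModel q p) M]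

theorem hasGroupoid_foliationGroupoid_of_le {k k' : ℕ∞} (h : k ≤ k')
    [HasGroupoid M (foliationGroupoid k' q p)] : HasGroupoid M (foliationGroupoid k q p) :=
  hasGroupoid_of_le inferInstance (foliationGroupoid_anti q p h)

theorem isManifold_of_foliationGroupoid {k : ℕ∞} [HasGroupoid M (foliationGroupoid k q p)] :
    IsManifold 𝓘(ℝ, FolModel q p) k M :=
  { hasGroupoid_of_le (inferInstanceAs (HasGroupoid M (foliationGroupoid k q p)))
      (foliationGroupoid_le_contDiffGroupoid k q p) with }

namespace IsFoliationChart

variable {e e' : OpenPartialHomeomorph M (FolModel q p)} {k k' : ℕ∞}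

theorem of_le (he : IsFoliationChart k' e) (h : k ≤ k') : IsFoliationChart k e :=
  ⟨StructureGroupoid.maximalAtlas_mono (foliationGroupoid_anti q p h) he.1, he.2⟩

theorem mem_maximalAtlas (he : IsFoliationChart k e) :
    e ∈ IsManifold.maximalAtlas 𝓘(ℝ, FolModel q p) k M :=
  StructureGroupoid.maximalAtlas_mono (foliationGroupoid_le_contDiffGroupoid k q p) he.1

theorem contMDiffAt [HasGroupoid M (foliationGroupoid k q p)] (he : IsFoliationChart k e) {x : M}
    (hx : x ∈ e.source) : ContMDiffAt 𝓘(ℝ, FolModel q p) 𝓘(ℝ, FolModel q p) k e x :=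
  haveI := isManifold_of_foliationGroupoid (M := M) (q := q) (p := p) (k := k)
  contMDiffAt_of_mem_maximalAtlas he.mem_maximalAtlas hx

theorem contMDiffAt_symm [HasGroupoid M (foliationGroupoid k q p)] (he : IsFoliationChart k e)
    {z : FolModel q p} (hz : z ∈ e.target) :
    ContMDiffAt 𝓘(ℝ, FolModel q p) 𝓘(ℝ, FolModel q p) k e.symm z :=
  haveI := isManifold_of_foliationGroupoid (M := M) (q := q) (p := p) (k := k)
  contMDiffAt_symm_of_mem_maximalAtlas he.mem_maximalAtlas hz

/-- Around each point, a change of foliation coordinates maps plaques into plaques. -/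
theorem exists_nhds_fst_eq [HasGroupoid M (foliationGroupoid k q p)] (he : IsFoliationChart k e)
    (he' : IsFoliationChart k e') {z : FolModel q p} (hz : z ∈ e.target)
    (hz' : e.symm z ∈ e'.source) :
    ∃ v ∈ 𝓝 z, ∀ a ∈ v, ∀ b ∈ v, a.1 = b.1 → a ∈ e.target ∧ b ∈ e.target ∧
      e.symm a ∈ e'.source ∧ e.symm b ∈ e'.source ∧
      (e' (e.symm a)).1 = (e' (e.symm b)).1 := by
  have hmem : e.symm ≫ₕ e' ∈ foliationGroupoid k q p :=
    StructureGroupoid.compatible_of_mem_maximalAtlas he.1 he'.1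
  obtain ⟨-, h⟩ := (mem_groupoid_of_pregroupoid.1 hmem).1
  have hz₁ : z ∈ (e.symm ≫ₕ e').source := by simp [hz, hz']
  obtain ⟨v, hv, h, hh⟩ := h z hz₁
  refine ⟨(e.symm ≫ₕ e').source ∩ v, inter_mem ((e.symm ≫ₕ e').open_source.mem_nhds hz₁) hv,
    fun a ha b hb hab => ?_⟩
  have h₁ := hh a ha
  have h₂ := hh b hb
  have ha₁ := ha.1
  have hb₁ := hb.1
  simp only [OpenPartialHomeomorph.trans_source, OpenPartialHomeomorph.symm_source, mem_inter_iff,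
    mem_preimage] at ha₁ hb₁
  simp only [OpenPartialHomeomorph.coe_trans, Function.comp_apply] at h₁ h₂
  exact ⟨ha₁.1, hb₁.1, ha₁.2, hb₁.2, by rw [h₁, h₂, hab]⟩

-- Balls for the sup norm of the product are products of balls, so restricting any chart to a small
-- ball gives an image `T × B` with `B` convex.
variable (k q p) in
theorem exists_mem_subset [HasGroupoid M (foliationGroupoid k q p)] {x : M} {O : Set M}
    (hO : IsOpen O) (hx : x ∈ O) :
    ∃ e : OpenPartialHomeomorph M (FolModel q p), IsFoliationChart k e ∧ x ∈ e.source ∧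
      e.source ⊆ O := by
  let c := chartAt (FolModel q p) x
  have hxc : x ∈ c.source := mem_chart_source _ x
  have hN : c.target ∩ c.symm ⁻¹' O ∈ 𝓝 (c x) :=
    (c.symm.isOpen_inter_preimage hO).mem_nhds
      ⟨c.map_source hxc, by simpa [c.left_inv hxc] using hx⟩
  obtain ⟨ε, hε, hball⟩ := Metric.mem_nhds_iff.1 hN
  let S : Set M := c.source ∩ c ⁻¹' Metric.ball (c x) ε
  have hS : IsOpen S := c.isOpen_inter_preimage Metric.isOpen_ball
  refine ⟨c.restr S, ⟨?_, Metric.ball (c x).1 ε, Metric.ball (c x).2 ε, Metric.isOpen_ball,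
    Metric.isOpen_ball, convex_ball _ _, ?_⟩, ?_, ?_⟩
  · exact restr_mem_maximalAtlas _ (StructureGroupoid.chart_mem_maximalAtlas _ x) hS
  · rw [ball_prod_same]
    ext z
    simp only [OpenPartialHomeomorph.restr_target, hS.interior_eq, mem_inter_iff, mem_preimage, S]
    constructor
    · rintro ⟨hz, -, h⟩
      rwa [c.right_inv hz] at h
    · intro hz
      have := (hball hz).1
      exact ⟨this, c.map_target this, by rwa [c.right_inv this]⟩
  · rw [OpenPartialHomeomorph.restr_source, hS.interior_eq]
    exact ⟨hxc, hxc, Metric.mem_ball_self hε⟩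
  · rw [OpenPartialHomeomorph.restr_source, hS.interior_eq]
    rintro y ⟨-, hy, hy'⟩
    have := (hball hy').2
    rwa [mem_preimage, c.left_inv hy] at this

/-- A plaque is the image of the convex set `B` under `σ`. Changes of charts locally preserve
plaques, so `σ` is continuous into the leaf topology; the plaque is therefore connected there and
lies in one leaf. -/
theorem leaf_eq_of_fst_eq [HasGroupoid M (foliationGroupoid 0 q p)] (he : IsFoliationChart 0 e)
    {x y : M} (hx : x ∈ e.source) (hy : y ∈ e.source) (hxy : (e x).1 = (e y).1) :
    leaf q p x = leaf q p y := by
  obtain ⟨T, B, -, -, hB, htarget⟩ := he.2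
  have hex : e x ∈ T ×ˢ B := htarget ▸ e.map_source hx
  have hey : e y ∈ T ×ˢ B := htarget ▸ e.map_source hy
  have hmem : ∀ b ∈ B, ((e x).1, b) ∈ e.target := fun b hb => htarget ▸ ⟨hex.1, hb⟩
  let σ : EuclideanSpace ℝ (Fin p) → M := fun b => e.symm ((e x).1, b)
  have hlocal : ∀ e₁ : OpenPartialHomeomorph M (FolModel q p), IsFoliationChart 0 e₁ → ∀ t,
      IsOpen ((fun b : B => σ b) ⁻¹' plaque e₁ t) := by
    intro e₁ he₁ t
    rw [isOpen_iff_mem_nhds]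
    rintro ⟨b, hb⟩ ⟨hb₁, hb₂⟩
    obtain ⟨v, hv, hvv⟩ := he.exists_nhds_fst_eq he₁ (hmem b hb) hb₁
    have hc : Continuous fun c : B => (((e x).1, (c : EuclideanSpace ℝ (Fin p))) : FolModel q p) :=
      by fun_prop
    filter_upwards [hc.continuousAt.preimage_mem_nhds (x := (⟨b, hb⟩ : B)) hv] with c hc
    obtain ⟨-, -, h₁, -, h₂⟩ := hvv _ hc _ (mem_of_mem_nhds hv) rfl
    exact ⟨h₁, h₂.trans hb₂⟩
  have hσ : @ContinuousOn _ M _ (leafTopology q p M) σ B := by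
    refine (@continuousOn_iff_continuous_domRestrict _ M _ (leafTopology q p M) _ _).2 ?_
    refine continuous_generateFrom_iff.2 ?_
    rintro _ ⟨e₁, he₁, t, rfl⟩
    exact hlocal e₁ he₁ t
  have hpre := @IsPreconnected.image _ M _ (leafTopology q p M) B hB.isPreconnected σ hσ
  have hx' : x ∈ σ '' B := ⟨(e x).2, hex.2, e.left_inv hx⟩
  have hy' : y ∈ σ '' B := ⟨(e y).2, hey.2, by simp only [σ, hxy]; exact e.left_inv hy⟩
  exact @connectedComponent_eq M (leafTopology q p M) _ _
    ((@IsPreconnected.subset_connectedComponent M (leafTopology q p M) _ _ hpre hx') hy')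

end IsFoliationChart

end FoliationCharts

/-! ### Constraints describing strong plaquewise neighbourhoods -/

section Constraints

variable {q p q' p' : ℕ} {M M' : Type*} [TopologicalSpace M] [ChartedSpace (FolModel q p) M]
  [TopologicalSpace M'] [ChartedSpace (FolModel q' p') M']

theorem IsFoliationChart.contDiffAt_localExpr {k : ℕ∞} [HasGroupoid M (foliationGroupoid k q p)]
    [HasGroupoid M' (foliationGroupoid k q' p')] {e : OpenPartialHomeomorph M (FolModel q p)}
    {e' : OpenPartialHomeomorph M' (FolModel q' p')} (he : IsFoliationChart k e)
    (he' : IsFoliationChart k e') {g : M → M'} {x : M}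
    (hg : ContMDiffAt 𝓘(ℝ, FolModel q p) 𝓘(ℝ, FolModel q' p') k g x)
    (hx : x ∈ e.source) (hgx : g x ∈ e'.source) :
    ContDiffAt ℝ k (e' ∘ g ∘ e.symm) (e x) := by
  rw [← contMDiffAt_iff_contDiffAt]
  have h₁ := he.contMDiffAt_symm (e.map_source hx)
  have h₂ : ContMDiffAt 𝓘(ℝ, FolModel q p) 𝓘(ℝ, FolModel q' p') k g (e.symm (e x)) := by
    rwa [e.left_inv hx]
  have h₃ := he'.contMDiffAt hgx
  refine ContMDiffAt.comp (e x) ?_ (h₂.comp (e x) h₁)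
  simpa [e.left_inv hx] using h₃

theorem IsFoliationChart.contMDiffAt_of_localExpr {k : ℕ∞}
    [HasGroupoid M (foliationGroupoid k q p)] [HasGroupoid M' (foliationGroupoid k q' p')]
    {e : OpenPartialHomeomorph M (FolModel q p)} {e' : OpenPartialHomeomorph M' (FolModel q' p')}
    (he : IsFoliationChart k e) (he' : IsFoliationChart k e')
    {H : FolModel q p → FolModel q' p'} {x : M} (hx : x ∈ e.source) (hHx : H (e x) ∈ e'.target)
    (hH : ContDiffAt ℝ k H (e x)) :
    ContMDiffAt 𝓘(ℝ, FolModel q p) 𝓘(ℝ, FolModel q' p') k (fun y => e'.symm (H (e y))) x :=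
  ContMDiffAt.comp x (he'.contMDiffAt_symm hHx)
    (ContMDiffAt.comp x hH.contMDiffAt (he.contMDiffAt hx))

variable (q p q' p' M M') in
/-- One of the conditions, indexed by `i`, which define the basic open set `spBasic`. -/
structure PlaqueConstraint (s : ℕ) where
  center : M → M'
  chart : OpenPartialHomeomorph M (FolModel q p)
  chart' : OpenPartialHomeomorph M' (FolModel q' p')
  K : Set M
  ε : ℝ
  contMDiff : ContMDiff 𝓘(ℝ, FolModel q p) 𝓘(ℝ, FolModel q' p') s center
  isFoliationChart : IsFoliationChart s chart
  isFoliationChart' : IsFoliationChart s chart'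
  isCompact : IsCompact K
  subset_source : K ⊆ chart.source
  mapsTo : MapsTo center K chart'.source

namespace PlaqueConstraint

variable {s : ℕ}

def SatisfiedAt (c : PlaqueConstraint q p q' p' M M' s) (g : M → M') (x : M) : Prop :=
  g x ∈ c.chart'.source ∧ (c.chart' (g x)).1 = (c.chart' (c.center x)).1 ∧
    ∀ j ≤ s, ‖iteratedFDeriv ℝ j (c.chart' ∘ g ∘ c.chart.symm) (c.chart x)
      - iteratedFDeriv ℝ j (c.chart' ∘ c.center ∘ c.chart.symm) (c.chart x)‖ < c.ε

def Satisfied (c : PlaqueConstraint q p q' p' M M' s) (g : M → M') : Prop :=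
  ∀ x ∈ c.K, c.SatisfiedAt g x

theorem SatisfiedAt.congr {c : PlaqueConstraint q p q' p' M M' s} {g g' : M → M'} {x : M}
    (h : c.SatisfiedAt g x) (hx : x ∈ c.K) (hg : g' =ᶠ[𝓝 x] g) : c.SatisfiedAt g' x := by
  have hxs := c.subset_source hx
  have hev : c.chart' ∘ g' ∘ c.chart.symm =ᶠ[𝓝 (c.chart x)] c.chart' ∘ g ∘ c.chart.symm := by
    have hc : Tendsto c.chart.symm (𝓝 (c.chart x)) (𝓝 x) := c.chart.tendsto_symm hxs
    filter_upwards [hc.eventually hg] with y hy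
    simp [hy]
  obtain ⟨h₁, h₂, h₃⟩ := h
  refine ⟨hg.eq_of_nhds ▸ h₁, hg.eq_of_nhds ▸ h₂, fun j hj => ?_⟩
  rw [(hev.iteratedFDeriv ℝ j).eq_of_nhds]
  exact h₃ j hj

/-- Lying in the chart domain and having jets strictly closer than `c.ε` are open conditions. Lying
in a prescribed plaque is not, hence the separate hypothesis `hfst`. The conclusion is uniform near
`x`, in view of a compactness argument over `c.K`. -/
theorem eventually_satisfiedAt [HasGroupoid M (foliationGroupoid s q p)]
    [HasGroupoid M' (foliationGroupoid s q' p')] {c : PlaqueConstraint q p q' p' M M' s}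
    {T : Type*} {l : Filter T} {G : T → M → M'} {g : M → M'} {x : M} (hx : x ∈ c.K)
    (hg : c.Satisfied g) (hG : Tendsto (fun a : T × M => G a.1 a.2) (l ×ˢ 𝓝 x) (𝓝 (g x)))
    (hfst : ∀ᶠ a : T × M in l ×ˢ 𝓝 x, (c.chart' (G a.1 a.2)).1 = (c.chart' (g a.2)).1)
    (hjet : JetTendsto s l (fun t => c.chart' ∘ G t ∘ c.chart.symm)
      (c.chart' ∘ g ∘ c.chart.symm) (c.chart x)) :
    ∀ᶠ a : T × M in l ×ˢ 𝓝 x, a.2 ∈ c.K → c.SatisfiedAt (G a.1) a.2 := by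
  have hxs := c.subset_source hx
  have hcenter : ContDiffAt ℝ s (c.chart' ∘ c.center ∘ c.chart.symm) (c.chart x) := by
    have := c.isFoliationChart.contDiffAt_localExpr c.isFoliationChart' (g := c.center) (x := x)
      (by exact_mod_cast c.contMDiff x) hxs (c.mapsTo hx)
    exact_mod_cast this
  have hpair : Tendsto (fun a : T × M => (a.1, c.chart a.2)) (l ×ˢ 𝓝 x)
      (l ×ˢ 𝓝 (c.chart x)) :=
    tendsto_fst.prodMk ((c.chart.continuousAt hxs).tendsto.comp tendsto_snd)
  have hnorm : ∀ j ≤ s, ∀ᶠ a : T × M in l ×ˢ 𝓝 x,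
      ‖iteratedFDeriv ℝ j (c.chart' ∘ G a.1 ∘ c.chart.symm) (c.chart a.2)
        - iteratedFDeriv ℝ j (c.chart' ∘ c.center ∘ c.chart.symm) (c.chart a.2)‖ < c.ε := by
    intro j hj
    have := (((hjet.tendsto j hj).sub
      ((JetTendsto.const (l := l) hcenter).tendsto j hj)).comp hpair).norm
    exact this.eventually_lt_const ((hg x hx).2.2 j hj)
  have hnorm' : ∀ᶠ a : T × M in l ×ˢ 𝓝 x, ∀ j ∈ Finset.range (s + 1),
      ‖iteratedFDeriv ℝ j (c.chart' ∘ G a.1 ∘ c.chart.symm) (c.chart a.2)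
        - iteratedFDeriv ℝ j (c.chart' ∘ c.center ∘ c.chart.symm) (c.chart a.2)‖ < c.ε :=
    (Finset.eventually_all _).2 fun j hj => hnorm j (by simpa [Nat.lt_succ_iff] using hj)
  filter_upwards [hfst, hnorm', hG (c.chart'.open_source.mem_nhds (hg x hx).1)]
    with a h₁ h₂ h₃ ha
  exact ⟨h₃, h₁.trans (hg a.2 ha).2.1, fun j hj => h₂ j (by simpa [Nat.lt_succ_iff] using hj)⟩

end PlaqueConstraint

end Constraints

/-! ### Smoothing in one chart -/

section Step

theorem exists_contDiff_bump {X : Type*} [NormedAddCommGroup X] [NormedSpace ℝ X]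
    [FiniteDimensional ℝ X] {A W L : Set X} (hA : IsClosed A) (hW : IsOpen W) (hAW : A ⊆ W)
    (hL : IsCompact L) (hWL : W ⊆ L) :
    ∃ χ : X → ℝ, ContDiff ℝ ∞ χ ∧ HasCompactSupport χ ∧ tsupport χ ⊆ W ∧
      ∀ z ∈ A, χ =ᶠ[𝓝 z] fun _ => 1 := by
  obtain ⟨χ, h0, h1, -⟩ := exists_contMDiffMap_zero_one_nhds_of_isClosed 𝓘(ℝ, X) (n := ⊤)
    hW.isClosed_compl hA (by rwa [← subset_compl_iff_disjoint_left, compl_compl])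
  have hsupp : tsupport χ ⊆ W := by
    intro z hz
    by_contra hzW
    exact notMem_tsupport_iff_eventuallyEq.2 (h0.filter_mono (nhds_le_nhdsSet hzW)) hz
  exact ⟨χ, χ.contMDiff.contDiff, hL.of_isClosed_subset (isClosed_tsupport _) (hsupp.trans hWL),
    hsupp, fun z hz => h1.filter_mono (nhds_le_nhdsSet hz)⟩

theorem FolModel.add_zero_zero {q p : ℕ} (z : FolModel q p) : z + ((0, 0) : FolModel q p) = z :=
  add_zero z

section Perturbation

variable {q p q' p' : ℕ} {M M' : Type*} [TopologicalSpace M] [TopologicalSpace M']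

/-- The map with local expression `z ↦ ((f z).1, (f z).2 + χ z • d z)` on `S`, where `f` is the local
expression of `g`, and which equals `g` outside `S`. -/
noncomputable def leafwisePerturbation (e : OpenPartialHomeomorph M (FolModel q p))
    (e' : OpenPartialHomeomorph M' (FolModel q' p')) (S : Set M) (χ : FolModel q p → ℝ)
    (d : FolModel q p → EuclideanSpace ℝ (Fin p')) (g : M → M') (x : M) : M' :=
  open scoped Classical in
  if x ∈ S then e'.symm (e' (g x) + (0, χ (e x) • d (e x))) else g x

variable {s : ℕ} {e : OpenPartialHomeomorph M (FolModel q p)}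
  {e' : OpenPartialHomeomorph M' (FolModel q' p')} {U S : Set M} {χ : FolModel q p → ℝ}
  {g : M → M'}

theorem leafwisePerturbation_of_notMem {d : FolModel q p → EuclideanSpace ℝ (Fin p')} {x : M}
    (hx : x ∉ S) : leafwisePerturbation e e' S χ d g x = g x := if_neg hx

/-- At points of `U` outside `S` the added vector vanishes, so one formula is valid on the whole of
`U`; regularity at boundary points of `S` can then be read off from it. -/
theorem leafwisePerturbation_of_mem {d : FolModel q p → EuclideanSpace ℝ (Fin p')}
    (hS : ∀ x ∈ U, χ (e x) ≠ 0 → x ∈ S) (hgU : MapsTo g U e'.source) {x : M} (hx : x ∈ U) :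
    leafwisePerturbation e e' S χ d g x = e'.symm (e' (g x) + (0, χ (e x) • d (e x))) := by
  by_cases hxS : x ∈ S
  · exact if_pos hxS
  · have h0 : χ (e x) = 0 := by_contra fun h => hxS (hS x hx h)
    rw [leafwisePerturbation_of_notMem hxS, h0, zero_smul,
      FolModel.add_zero_zero, e'.left_inv (hgU hx)]

theorem tendsto_leafwisePerturbation_coord {T : Type*} {l : Filter T}
    {d : T → FolModel q p → EuclideanSpace ℝ (Fin p')} {x : M} (hx : x ∈ e.source)
    (hgx : g x ∈ e'.source) (hg : ContinuousAt g x) (hχ : Continuous χ)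
    (hd : JetTendsto s l d (fun _ => 0) (e x)) :
    Tendsto (fun a : T × M => e' (g a.2) + (0, χ (e a.2) • d a.1 (e a.2))) (l ×ˢ 𝓝 x)
      (𝓝 (e' (g x))) := by
  have h₁ : Tendsto (fun a : T × M => e a.2) (l ×ˢ 𝓝 x) (𝓝 (e x)) :=
    (e.continuousAt hx).tendsto.comp tendsto_snd
  have h₂ : Tendsto (fun a : T × M => e' (g a.2)) (l ×ˢ 𝓝 x) (𝓝 (e' (g x))) :=
    ((e'.continuousAt hgx).tendsto.comp hg.tendsto).comp tendsto_snd
  have h₃ : Tendsto (fun a : T × M => d a.1 (e a.2)) (l ×ˢ 𝓝 x) (𝓝 0) :=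
    hd.tendsto_apply.comp (tendsto_fst.prodMk h₁)
  have h₄ := ((hχ.tendsto _).comp h₁).smul h₃
  have h₅ := h₂.add ((tendsto_const_nhds (x := (0 : EuclideanSpace ℝ (Fin q')))).prodMk_nhds h₄)
  rwa [smul_zero, FolModel.add_zero_zero] at h₅

variable [ChartedSpace (FolModel q p) M] [ChartedSpace (FolModel q' p') M']

theorem JetTendsto.leafwisePerturbation [HasGroupoid M (foliationGroupoid s q p)]
    [HasGroupoid M' (foliationGroupoid s q' p')] {Θ : OpenPartialHomeomorph M (FolModel q p)}
    {Θ' : OpenPartialHomeomorph M' (FolModel q' p')} (hΘ : IsFoliationChart s Θ)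
    (hΘ' : IsFoliationChart s Θ') (he : IsFoliationChart s e) (he' : IsFoliationChart s e')
    {T : Type*} {l : Filter T} {d : T → FolModel q p → EuclideanSpace ℝ (Fin p')} {x : M}
    (hU : IsOpen U) (hUe : U ⊆ e.source) (hgU : MapsTo g U e'.source)
    (hS : ∀ x ∈ U, χ (e x) ≠ 0 → x ∈ S) (hχ : ContDiff ℝ ∞ χ)
    (hg : ContMDiffAt 𝓘(ℝ, FolModel q p) 𝓘(ℝ, FolModel q' p') s g x) (hx : x ∈ U)
    (hxΘ : x ∈ Θ.source) (hgx : g x ∈ Θ'.source) (hd : JetTendsto s l d (fun _ => 0) (e x)) :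
    JetTendsto s l (fun t => Θ' ∘ leafwisePerturbation e e' S χ (d t) g ∘ Θ.symm)
      (Θ' ∘ g ∘ Θ.symm) (Θ x) := by
  have hτ : ContDiffAt ℝ s (e ∘ Θ.symm) (Θ x) := by
    have := hΘ.contDiffAt_localExpr he (g := id) (x := x) contMDiffAt_id hxΘ (hUe hx)
    exact_mod_cast this
  have hm : ContDiffAt ℝ s (e' ∘ g ∘ Θ.symm) (Θ x) := by
    have := hΘ.contDiffAt_localExpr he' (g := g) (x := x) (by exact_mod_cast hg) hxΘ (hgU hx)
    exact_mod_cast this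
  have hc : ContDiffAt ℝ s (Θ' ∘ e'.symm) (e' (g x)) := by
    have := he'.contDiffAt_localExpr hΘ' (g := id) (x := g x) contMDiffAt_id (hgU hx) hgx
    exact_mod_cast this
  have hχs : ContDiff ℝ s χ := hχ.of_le (by exact_mod_cast le_top)
  -- The perturbed local expression is a fixed `C^s` map, `(Θ' ∘ e'.symm) ∘ Ψ`, applied to the pair
  -- of `y` and the value of `d t` at `e (Θ.symm y)`. Only the second entry depends on `t`, and its
  -- jets tend to zero.
  let Ψ : FolModel q p × EuclideanSpace ℝ (Fin p') → FolModel q' p' := fun a =>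
    (e' ∘ g ∘ Θ.symm) a.1 + (0, χ ((e ∘ Θ.symm) a.1) • a.2)
  have hΨ : ContDiffAt ℝ s Ψ (Θ x, 0) := by
    have h₁ := hm.comp (Θ x, (0 : EuclideanSpace ℝ (Fin p'))) contDiffAt_fst
    have h₂ := (hχs.contDiffAt.comp (Θ x) hτ).comp
      (Θ x, (0 : EuclideanSpace ℝ (Fin p'))) contDiffAt_fst
    exact h₁.add ((contDiffAt_const (c := (0 : EuclideanSpace ℝ (Fin q')))).prodMk
      (h₂.smul contDiffAt_snd))
  have hΨ0 : Ψ (Θ x, 0) = e' (g x) := by simp [Ψ, FolModel.add_zero_zero, Θ.left_inv hxΘ]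
  have hΦ : ContDiffAt ℝ s ((Θ' ∘ e'.symm) ∘ Ψ) (Θ x, 0) :=
    ContDiffAt.comp _ (by rwa [hΨ0]) hΨ
  have hdτ : JetTendsto s l (fun t => d t ∘ (e ∘ Θ.symm)) ((fun _ => 0) ∘ (e ∘ Θ.symm)) (Θ x) :=
    JetTendsto.comp (by simpa [Θ.left_inv hxΘ] using hd) (.const hτ)
  have hpair := (JetTendsto.const (l := l) (s := s) (x := Θ x) contDiffAt_id).prodMk hdτ
  have hmain := JetTendsto.comp (f₀ := fun y => (id y, ((fun _ => 0) ∘ (e ∘ Θ.symm)) y))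
    (.const (l := l) hΦ) hpair
  refine hmain.congr (O := Θ.target ∩ Θ.symm ⁻¹' U)
    ((Θ.symm.isOpen_inter_preimage hU).mem_nhds
      ⟨Θ.map_source hxΘ, by simpa [Θ.left_inv hxΘ] using hx⟩) ?_ ?_
  · rintro t y ⟨-, hy⟩
    simp only [Function.comp_apply, id, Ψ]
    rw [leafwisePerturbation_of_mem hS hgU hy]
  · rintro y ⟨-, hy⟩
    have := e'.left_inv (hgU hy)
    simp [Ψ, FolModel.add_zero_zero, this]

theorem contMDiffAt_leafwisePerturbation {k : ℕ∞} [HasGroupoid M (foliationGroupoid k q p)]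
    [HasGroupoid M' (foliationGroupoid k q' p')] (he : IsFoliationChart k e)
    (he' : IsFoliationChart k e') {d : FolModel q p → EuclideanSpace ℝ (Fin p')} {x : M}
    (hU : IsOpen U) (hUe : U ⊆ e.source) (hgU : MapsTo g U e'.source)
    (hS : ∀ x ∈ U, χ (e x) ≠ 0 → x ∈ S) (hx : x ∈ U)
    (ht : e' (g x) + (0, χ (e x) • d (e x)) ∈ e'.target)
    (hH : ContDiffAt ℝ k (fun z => e' (g (e.symm z)) + (0, χ z • d z)) (e x)) :
    ContMDiffAt 𝓘(ℝ, FolModel q p) 𝓘(ℝ, FolModel q' p') k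
      (leafwisePerturbation e e' S χ d g) x := by
  have hxe := hUe hx
  refine (he.contMDiffAt_of_localExpr he' hxe (by rwa [e.left_inv hxe]) hH).congr_of_eventuallyEq ?_
  filter_upwards [hU.mem_nhds hx] with y hy
  rw [leafwisePerturbation_of_mem hS hgU hy, e.left_inv (hUe hy)]

theorem PlaqueConstraint.eventually_satisfied_leafwisePerturbation
    [HasGroupoid M (foliationGroupoid s q p)]
    [HasGroupoid M' (foliationGroupoid s q' p')] {c : PlaqueConstraint q p q' p' M M' s}
    (he : IsFoliationChart s e) (he' : IsFoliationChart s e')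
    {T : Type*} {l : Filter T} {d : T → FolModel q p → EuclideanSpace ℝ (Fin p')}
    (hU : IsOpen U) (hUe : U ⊆ e.source) (hgU : MapsTo g U e'.source)
    (hS : ∀ x ∈ U, χ (e x) ≠ 0 → x ∈ S) (hSU : S ⊆ U) (hSc : IsClosed S) (hχ : ContDiff ℝ ∞ χ)
    (hg : ContMDiff 𝓘(ℝ, FolModel q p) 𝓘(ℝ, FolModel q' p') s g)
    (hd : ∀ z, JetTendsto s l d (fun _ => 0) z) (hc : c.Satisfied g) :
    ∀ᶠ t in l, c.Satisfied (leafwisePerturbation e e' S χ (d t) g) := by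
  -- By compactness of `c.K`, the local statements yield one condition on `t` valid at all points of
  -- `c.K`.
  suffices h : ∀ x ∈ c.K, ∀ᶠ a : T × M in l ×ˢ 𝓝 x,
      a.2 ∈ c.K → c.SatisfiedAt (leafwisePerturbation e e' S χ (d a.1) g) a.2 by
    have h' := c.isCompact.mem_prod_nhdsSet_of_forall h
    exact (Eventually.curry h').mono fun t ht x hx => ht.self_of_nhdsSet x hx hx
  intro x hx
  by_cases hxS : x ∈ S
  · have hxU := hSU hxS
    have hgx := (hc x hx).1
    have ht := tendsto_leafwisePerturbation_coord (l := l) (hUe hxU) (hgU hxU)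
      hg.continuous.continuousAt hχ.continuous (hd (e x))
    have hev : ∀ᶠ a : T × M in l ×ˢ 𝓝 x, a.2 ∈ U := tendsto_snd (hU.mem_nhds hxU)
    refine PlaqueConstraint.eventually_satisfiedAt hx hc ?_ ?_
      (.leafwisePerturbation c.isFoliationChart c.isFoliationChart' he he' hU hUe hgU hS hχ
        (hg x) hxU (c.subset_source hx) hgx (hd _))
    · have := ((e'.tendsto_symm (hgU hxU))).comp ht
      refine this.congr' ?_
      filter_upwards [hev] with a ha
      rw [leafwisePerturbation_of_mem hS hgU ha]
      rfl
    -- The perturbation preserves the first coordinate of `e'`, and near `e' (g x)` points with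
    -- equal first coordinates also have equal first coordinates in `c.chart'`.
    · obtain ⟨v, hv, hvv⟩ := he'.exists_nhds_fst_eq c.isFoliationChart'
        (e'.map_source (hgU hxU)) (by rwa [e'.left_inv (hgU hxU)])
      have ht' : Tendsto (fun a : T × M => e' (g a.2)) (l ×ˢ 𝓝 x) (𝓝 (e' (g x))) :=
        ((e'.continuousAt (hgU hxU)).tendsto.comp hg.continuous.continuousAt.tendsto).comp
          tendsto_snd
      filter_upwards [hev, ht hv, ht' hv] with a ha h₁ h₂
      rw [leafwisePerturbation_of_mem hS hgU ha, (hvv _ h₁ _ h₂ (by simp)).2.2.2.2,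
        e'.left_inv (hgU ha)]
  · have hev : ∀ᶠ a : T × M in l ×ˢ 𝓝 x, a.2 ∈ Sᶜ := tendsto_snd (hSc.isOpen_compl.mem_nhds hxS)
    filter_upwards [hev] with a ha haK
    refine (hc a.2 haK).congr haK ?_
    filter_upwards [hSc.isOpen_compl.mem_nhds ha] with y hy
    exact leafwisePerturbation_of_notMem hy

end Perturbation

variable {q p q' p' : ℕ} {M M' : Type*} [TopologicalSpace M] [ChartedSpace (FolModel q p) M]
  [TopologicalSpace M'] [ChartedSpace (FolModel q' p') M']

/-- A map which is transversely `C^r` on `U` can be made `C^r` on `V` by a small plaquewise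
perturbation supported in `U`. -/
theorem exists_leafwise_smoothing {r : ℕ∞} {s : ℕ} (hsr : (s : ℕ∞) ≤ r) [T2Space M]
    [HasGroupoid M (foliationGroupoid r q p)] [HasGroupoid M' (foliationGroupoid r q' p')]
    {ι : Type*} {C : ι → PlaqueConstraint q p q' p' M M' s}
    (hC : LocallyFinite fun i => (C i).K) {e : OpenPartialHomeomorph M (FolModel q p)}
    {e' : OpenPartialHomeomorph M' (FolModel q' p')} (he : IsFoliationChart r e)
    (he' : IsFoliationChart r e') {U V : Set M} (hU : IsOpen U) (hUc : IsCompact (closure U))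
    (hUe : closure U ⊆ e.source) (hVU : closure V ⊆ U) {g : M → M'}
    (hg : ContMDiff 𝓘(ℝ, FolModel q p) 𝓘(ℝ, FolModel q' p') s g)
    (hgC : ∀ i, (C i).Satisfied g) (hgU : MapsTo g U e'.source)
    (hfst : ContMDiffOn 𝓘(ℝ, FolModel q p) 𝓘(ℝ, EuclideanSpace ℝ (Fin q')) r
      (fun x => (e' (g x)).1) U) :
    ∃ g' : M → M', ContMDiff 𝓘(ℝ, FolModel q p) 𝓘(ℝ, FolModel q' p') s g' ∧
      (∀ i, (C i).Satisfied g') ∧ EqOn g' g Uᶜ ∧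
      (∀ x, ContMDiffAt 𝓘(ℝ, FolModel q p) 𝓘(ℝ, FolModel q' p') r g x →
        ContMDiffAt 𝓘(ℝ, FolModel q p) 𝓘(ℝ, FolModel q' p') r g' x) ∧
      ∀ x ∈ V, ContMDiffAt 𝓘(ℝ, FolModel q p) 𝓘(ℝ, FolModel q' p') r g' x := by
  have : HasGroupoid M (foliationGroupoid s q p) := hasGroupoid_foliationGroupoid_of_le hsr
  have : HasGroupoid M' (foliationGroupoid s q' p') := hasGroupoid_foliationGroupoid_of_le hsr
  have hUs : U ⊆ e.source := subset_closure.trans hUe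
  have hVc : IsCompact (closure V) :=
    hUc.of_isClosed_subset isClosed_closure (hVU.trans subset_closure)
  obtain ⟨χ, hχ, hχc, hχU, hχV⟩ := exists_contDiff_bump
    (hVc.image_of_continuousOn (e.continuousOn.mono (hVU.trans hUs))).isClosed
    ((e.isOpen_image_iff_of_subset_source hUs).2 hU) (image_mono hVU)
    (hUc.image_of_continuousOn (e.continuousOn.mono hUe)) (image_mono subset_closure)
  have hχs : ContDiff ℝ s χ := hχ.of_le (by exact_mod_cast le_top)
  let f : FolModel q p → FolModel q' p' := e' ∘ g ∘ e.symm
  have hf : ∀ x ∈ U, ContDiffAt ℝ s f (e x) := fun x hx => by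
    have := (he.of_le hsr).contDiffAt_localExpr (he'.of_le hsr) (g := g) (x := x)
      (by exact_mod_cast hg x) (hUs hx) (hgU hx)
    exact_mod_cast this
  -- Outside the image of `U` the values of `f` are meaningless, but `χ` kills them, so `w` is
  -- globally `C^s`.
  let w : FolModel q p → EuclideanSpace ℝ (Fin p') := fun z => χ z • (f z).2
  have hw : ContDiff ℝ s w := by
    rw [contDiff_iff_contDiffAt]
    intro z
    by_cases hz : z ∈ tsupport χ
    · obtain ⟨x, hx, rfl⟩ := hχU hz
      exact hχs.contDiffAt.smul (hf x hx).snd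
    · refine (contDiffAt_const (c := 0)).congr_of_eventuallyEq ?_
      filter_upwards [notMem_tsupport_iff_eventuallyEq.1 hz] with y hy
      simp [w, hy]
  have hwc : HasCompactSupport w := hχc.smul_right
  obtain ⟨d, hd, hd0⟩ := exists_contDiff_add_jetTendsto_zero hw hwc
  let S : Set M := e.symm '' tsupport χ
  have hSU : S ⊆ U := by
    rintro _ ⟨z, hz, rfl⟩
    obtain ⟨x, hx, rfl⟩ := hχU hz
    rwa [e.left_inv (hUs hx)]
  have htarget : tsupport χ ⊆ e.target := fun z hz => by
    obtain ⟨x, hx, rfl⟩ := hχU hz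
    exact e.map_source (hUs hx)
  have hSc : IsCompact S := hχc.isCompact.image_of_continuousOn
    (e.symm.continuousOn.mono htarget)
  have hS : ∀ x ∈ U, χ (e x) ≠ 0 → x ∈ S := fun x hx h =>
    ⟨e x, subset_tsupport χ h, e.left_inv (hUs hx)⟩
  have htgt : ∀ᶠ n in atTop, ∀ x ∈ S, e' (g x) + (0, χ (e x) • d n (e x)) ∈ e'.target := by
    have := hSc.mem_prod_nhdsSet_of_forall (l := atTop)
      (s := {a : ℕ × M | e' (g a.2) + (0, χ (e a.2) • d a.1 (e a.2)) ∈ e'.target})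
      fun x hx => tendsto_leafwisePerturbation_coord (hUs (hSU hx)) (hgU (hSU hx))
        hg.continuous.continuousAt hχ.continuous (hd0 (e x))
        (e'.open_target.mem_nhds (e'.map_source (hgU (hSU hx))))
    exact (Eventually.curry this).mono fun n hn x hx => hn.self_of_nhdsSet x hx
  -- The map changes only on the compact set `S`, so finitely many constraints are at stake and one
  -- `n` serves for all.
  have hfin : {i | ((C i).K ∩ S).Nonempty}.Finite := hC.finite_nonempty_inter_compact hSc
  have hsat : ∀ᶠ n in atTop, ∀ i ∈ {i | ((C i).K ∩ S).Nonempty},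
      (C i).Satisfied (leafwisePerturbation e e' S χ (d n) g) :=
    (Set.Finite.eventually_all hfin).2 fun i _ =>
      PlaqueConstraint.eventually_satisfied_leafwisePerturbation (he.of_le hsr) (he'.of_le hsr)
        hU hUs hgU hS hSU hSc.isClosed hχ hg hd0 (hgC i)
  obtain ⟨n, hn, hn'⟩ := (htgt.and hsat).exists
  have hnU : ∀ x ∈ U, e' (g x) + (0, χ (e x) • d n (e x)) ∈ e'.target := fun x hx => by
    by_cases h : χ (e x) = 0
    · rw [h, zero_smul, FolModel.add_zero_zero]
      exact e'.map_source (hgU hx)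
    · exact hn x (hS x hx h)
  have hoff : ∀ x ∉ S, leafwisePerturbation e e' S χ (d n) g =ᶠ[𝓝 x] g := fun x hx => by
    filter_upwards [hSc.isClosed.isOpen_compl.mem_nhds hx] with y hy
    exact leafwisePerturbation_of_notMem hy
  -- Since `d n` is a smooth map minus `w = χ f₂`, it is as regular as `f` at each point; this is
  -- why no existing regularity is lost.
  have hdn : ∀ {k : ℕ∞} {z}, ContDiffAt ℝ k f z → ContDiffAt ℝ k (d n) z := by
    intro k z hz
    have h₁ : ContDiffAt ℝ k (fun z => w z + d n z) z :=
      ((hd n).of_le (by exact_mod_cast le_top)).contDiffAt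
    have h₂ : ContDiffAt ℝ k w z :=
      (hχ.of_le (by exact_mod_cast le_top)).contDiffAt.smul hz.snd
    simpa using h₁.sub h₂
  have hkeep : ∀ {k : ℕ∞}, k ≤ r → ∀ x,
      ContMDiffAt 𝓘(ℝ, FolModel q p) 𝓘(ℝ, FolModel q' p') k g x →
      ContMDiffAt 𝓘(ℝ, FolModel q p) 𝓘(ℝ, FolModel q' p') k
        (leafwisePerturbation e e' S χ (d n) g) x := by
    intro k hk x hx
    have : HasGroupoid M (foliationGroupoid k q p) := hasGroupoid_foliationGroupoid_of_le hk
    have : HasGroupoid M' (foliationGroupoid k q' p') := hasGroupoid_foliationGroupoid_of_le hk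
    by_cases hxS : x ∈ S
    · have hxU := hSU hxS
      refine contMDiffAt_leafwisePerturbation (he.of_le hk) (he'.of_le hk) hU hUs hgU hS hxU
        (hnU x hxU) ?_
      have hfk : ContDiffAt ℝ k f (e x) :=
        (he.of_le hk).contDiffAt_localExpr (he'.of_le hk) hx (hUs hxU) (hgU hxU)
      exact hfk.add (contDiffAt_const.prodMk
        ((hχ.of_le (by exact_mod_cast le_top)).contDiffAt.smul (hdn hfk)))
    · exact hx.congr_of_eventuallyEq (hoff x hxS)
  refine ⟨leafwisePerturbation e e' S χ (d n) g, fun x => ?_, fun i => ?_, fun x hx => ?_,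
    hkeep le_rfl, fun x hx => ?_⟩
  · have := hkeep hsr x (by exact_mod_cast hg x)
    exact_mod_cast this
  · by_cases hi : ((C i).K ∩ S).Nonempty
    · exact hn' i hi
    · exact fun x hx => (hgC i x hx).congr hx (hoff x fun h => hi ⟨x, hx, h⟩)
  · exact leafwisePerturbation_of_notMem fun h => hx (hSU h)
  · have hxU : x ∈ U := hVU (subset_closure hx)
    have hxe := hUs hxU
    refine contMDiffAt_leafwisePerturbation he he' hU hUs hgU hS hxU (hnU x hxU) ?_
    have h₁ : ContDiffAt ℝ r (fun z => (f z).1) (e x) := by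
      rw [← contMDiffAt_iff_contDiffAt]
      have := (hfst.contMDiffAt (hU.mem_nhds hxU))
      exact ContMDiffAt.comp (g := fun x => (e' (g x)).1) (e x) (by rwa [e.left_inv hxe])
        (he.contMDiffAt_symm (e.map_source hxe))
    have h₂ : ContDiffAt ℝ r (fun z => w z + d n z) (e x) :=
      ((hd n).of_le (by exact_mod_cast le_top)).contDiffAt
    -- Near `e x` one has `χ = 1`, so `f₂ + χ d n = w + d n` there.
    refine (h₁.prodMk h₂).congr_of_eventuallyEq ?_
    filter_upwards [hχV (e x) ⟨x, subset_closure hx, rfl⟩] with z hz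
    ext1 <;> simp [w, f, hz]

end Step

/-! ### Locally finite sequences of modifications -/

/-- Infinitely many successive modifications of a map, supported in a locally finite family of
sets, have a well defined result, which locally is the result of finitely many of them. -/
theorem LocallyFinite.exists_successive_modification {X Y ι : Type*} [TopologicalSpace X]
    [Countable ι] {U V : ι → Set X} (hU : LocallyFinite U) {P : (X → Y) → Prop}
    {D : (X → Y) → X → Prop}
    (step : ∀ a g, P g → ∃ g', P g' ∧ EqOn g' g (U a)ᶜ ∧ (∀ x, D g x → D g' x) ∧
      ∀ x ∈ V a, D g' x) {φ : X → Y} (hφ : P φ) :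
    ∃ F : X → Y, EqOn F φ (⋃ a, U a)ᶜ ∧
      ∀ x, ∃ g, P g ∧ F =ᶠ[𝓝 x] g ∧ (D φ x → D g x) ∧ (x ∈ ⋃ a, V a → D g x) := by
  -- Indices are processed in the order of their codes; at integers that code no index the map is
  -- left unchanged.
  obtain ⟨c, hc⟩ := exists_injective_nat ι
  have step' : ∀ n (g : {g // P g}), ∃ g' : {g // P g},
      (∀ x, (∀ a, c a = n → x ∉ U a) → g'.1 x = g.1 x) ∧ (∀ x, D g.1 x → D g'.1 x) ∧
        ∀ a, c a = n → ∀ x ∈ V a, D g'.1 x := by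
    rintro n ⟨g, hg⟩
    by_cases hn : ∃ a, c a = n
    · obtain ⟨a, rfl⟩ := hn
      obtain ⟨g', h₁, h₂, h₃, h₄⟩ := step a g hg
      refine ⟨⟨g', h₁⟩, fun x hx => h₂ (hx a rfl), h₃, fun b hb => ?_⟩
      rwa [hc hb]
    · exact ⟨⟨g, hg⟩, fun x _ => rfl, fun x hx => hx, fun a ha => (hn ⟨a, ha⟩).elim⟩
  choose next hnext₁ hnext₂ hnext₃ using step'
  let G : ℕ → {g // P g} := fun n => Nat.rec ⟨φ, hφ⟩ next n
  have hfin : LocallyFinite fun n => {x | (G (n + 1)).1 x ≠ (G n).1 x} := by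
    intro x
    obtain ⟨t, ht, hfin⟩ := hU x
    refine ⟨t, ht, (hfin.image c).subset ?_⟩
    rintro n ⟨y, hy, hyt⟩
    have : ∃ a, c a = n ∧ y ∈ U a := by
      by_contra! h
      exact hy (hnext₁ n (G n) y h)
    obtain ⟨a, ha, hya⟩ := this
    exact ⟨a, ⟨y, hya, hyt⟩, ha⟩
  obtain ⟨F, hF⟩ :=
    LocallyFinite.exists_forall_eventually_atTop_eventuallyEq (f := fun n => (G n).1) hfin
  have hmono : ∀ x m n, m ≤ n → D (G m).1 x → D (G n).1 x := fun x m n hmn h =>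
    Nat.le_induction h (fun n _ ih => hnext₂ n (G n) x ih) n hmn
  refine ⟨F, fun x hx => ?_, fun x => ?_⟩
  · have heq : ∀ n, (G n).1 x = φ x := fun n => by
      induction n with
      | zero => rfl
      | succ n ih => exact (hnext₁ n (G n) x fun a _ ha => hx (mem_iUnion.2 ⟨a, ha⟩)).trans ih
    obtain ⟨n, hn⟩ := (hF x).exists
    exact hn.eq_of_nhds.symm.trans (heq n)
  · by_cases hx : x ∈ ⋃ a, V a
    · obtain ⟨a, ha⟩ := mem_iUnion.1 hx
      -- `G (c a + 1)` is the map just after the modification of index `a`; from then on `D` holds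
      -- at `x`.
      obtain ⟨n, hn, hn'⟩ := ((hF x).and (eventually_ge_atTop (c a + 1))).exists
      exact ⟨(G n).1, (G n).2, hn.symm, hmono x 0 n (Nat.zero_le n),
        fun _ => hmono x _ n hn' (hnext₃ _ _ a rfl x ha)⟩
    · obtain ⟨n, hn⟩ := (hF x).exists
      exact ⟨(G n).1, (G n).2, hn.symm, hmono x 0 n (Nat.zero_le n), fun h => (hx h).elim⟩

/-! ### From neighbourhoods to constraints -/

section Neighbourhoods

variable {q p q' p' : ℕ} {M M' : Type*} [TopologicalSpace M] [ChartedSpace (FolModel q p) M]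
  [TopologicalSpace M'] [ChartedSpace (FolModel q' p') M']

/-- Each neighbourhood for the strong plaquewise topology is given by a locally finite family of
constraints. -/
theorem exists_constraints_of_mem_nhds {s : ℕ} {φ : FolMap q p q' p' M M' s}
    {N : Set (FolMap q p q' p' M M' s)} (hN : N ∈ 𝓝 φ) :
    ∃ (ι : Type) (C : ι → PlaqueConstraint q p q' p' M M' s),
      LocallyFinite (fun i => (C i).K) ∧ (∀ i, (C i).Satisfied φ.toFun) ∧
      ∀ ψ : FolMap q p q' p' M M' s, (∀ i, (C i).Satisfied ψ.toFun) → ψ ∈ N := by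
  -- Sets containing all maps that obey some such family form a filter, with intersections given by
  -- disjoint unions of families. Hence only the generators of the topology that contain `φ` need
  -- checking. Such a generator may be centred at another map `φ₀`, which the constraints keep as
  -- their `center`.
  let F : Filter (FolMap q p q' p' M M' s) :=
    { sets := {N | ∃ (ι : Type) (C : ι → PlaqueConstraint q p q' p' M M' s),
        LocallyFinite (fun i => (C i).K) ∧ (∀ i, (C i).Satisfied φ.toFun) ∧
        ∀ ψ : FolMap q p q' p' M M' s, (∀ i, (C i).Satisfied ψ.toFun) → ψ ∈ N}
      univ_sets := ⟨Empty, Empty.elim, locallyFinite_of_finite _, fun i => i.elim,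
        fun _ _ => mem_univ _⟩
      sets_of_superset := by
        rintro N N' ⟨ι, C, h₁, h₂, h₃⟩ hNN'
        exact ⟨ι, C, h₁, h₂, fun ψ hψ => hNN' (h₃ ψ hψ)⟩
      inter_sets := by
        rintro N N' ⟨ι, C, h₁, h₂, h₃⟩ ⟨ι', C', h₁', h₂', h₃'⟩
        refine ⟨ι ⊕ ι', Sum.elim C C', ?_, ?_, fun ψ hψ => ⟨h₃ ψ fun i => hψ (Sum.inl i),
          h₃' ψ fun i => hψ (Sum.inr i)⟩⟩
        · have := h₁.sumElim h₁'
          convert this using 1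
          ext (i | i) <;> rfl
        · rintro (i | i)
          · exact h₂ i
          · exact h₂' i }
  have hF : F ≤ 𝓝 φ := by
    rw [TopologicalSpace.nhds_generateFrom]
    refine le_iInf₂ fun N hN => le_principal_iff.2 ?_
    obtain ⟨hφ, φ₀, ι, Θ, Θ', K, ε, hΘ, hfin, hΘ', hK, -, rfl⟩ := hN
    refine ⟨ι, fun i => ⟨φ₀.toFun, Θ i, Θ' i, K i, ε i, φ₀.contMDiff, hΘ i, hΘ' i, (hK i).1,
      (hK i).2.1, (hK i).2.2⟩, hfin.subset fun i => (hK i).2.1, fun i x hx => hφ i x hx,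
      fun ψ hψ i x hx => hψ i x hx⟩
  exact hF hN

end Neighbourhoods

/-! ### Globalization -/

section Approximation

variable {q p q' p' : ℕ} {M M' : Type*}
    [TopologicalSpace M] [T2Space M] [SecondCountableTopology M] [ChartedSpace (FolModel q p) M]
    [TopologicalSpace M'] [ChartedSpace (FolModel q' p') M']

theorem exists_countable_foliation_cover (r : ℕ∞) [HasGroupoid M (foliationGroupoid r q p)]
    [HasGroupoid M' (foliationGroupoid r q' p')] {φ : M → M'} (hφ : Continuous φ) {A W : Set M}
    (hA : IsClosed A) (hW : IsOpen W) (hAW : A ⊆ W) :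
    ∃ (I : Set A) (e : I → OpenPartialHomeomorph M (FolModel q p))
      (e' : I → OpenPartialHomeomorph M' (FolModel q' p')) (U V : I → Set M),
      Countable I ∧ LocallyFinite U ∧ A ⊆ ⋃ a, V a ∧
      ∀ a, IsFoliationChart r (e a) ∧ IsFoliationChart r (e' a) ∧ IsOpen (U a) ∧
        IsCompact (closure (U a)) ∧ closure (U a) ⊆ (e a).source ∧ (e a).source ⊆ W ∧
        MapsTo φ (e a).source (e' a).source ∧ closure (V a) ⊆ U a := by
  have : LocallyCompactSpace M := ChartedSpace.locallyCompactSpace (FolModel q p) M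
  have hloc : ∀ x : A, ∃ (e : OpenPartialHomeomorph M (FolModel q p))
      (e' : OpenPartialHomeomorph M' (FolModel q' p')) (K : Set M), IsFoliationChart r e ∧
      IsFoliationChart r e' ∧ e.source ⊆ W ∧ MapsTo φ e.source e'.source ∧ IsCompact K ∧
      (x : M) ∈ interior K ∧ K ⊆ e.source := by
    rintro ⟨x, hx⟩
    obtain ⟨e', he', hxe', -⟩ :=
      IsFoliationChart.exists_mem_subset q' p' r isOpen_univ (mem_univ (φ x))
    obtain ⟨e, he, hxe, hsub⟩ := IsFoliationChart.exists_mem_subset q p r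
      (hW.inter (e'.open_source.preimage hφ)) ⟨hAW hx, hxe'⟩
    obtain ⟨K, hK, hxK, hKe⟩ := exists_compact_subset e.open_source hxe
    exact ⟨e, e', K, he, he', fun y hy => (hsub hy).1, fun y hy => (hsub hy).2, hK, hxK, hKe⟩
  choose e e' K he he' hsW hmaps hK hxK hKe using hloc
  obtain ⟨U, hUo, hAU, hUfin, hUK⟩ := precise_refinement_set hA (fun x : A => interior (K x))
    (fun _ => isOpen_interior) fun x hx => mem_iUnion.2 ⟨⟨x, hx⟩, hxK _⟩
  obtain ⟨V, hAV, -, hVU⟩ := exists_subset_iUnion_closure_subset hA hUo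
    (fun x _ => hUfin.point_finite x) hAU
  have hcl : ∀ a, closure (U a) ⊆ K a := fun a =>
    closure_minimal ((hUK a).trans interior_subset) (hK a).isClosed
  -- A locally finite family of nonempty sets in a second countable space is countable, so
  -- discarding the empty members makes the successive modification possible.
  let I : Set A := {a | (U a).Nonempty}
  have hUI : LocallyFinite fun a : I => U a := hUfin.comp_injective Subtype.val_injective
  refine ⟨I, fun a => e a, fun a => e' a, fun a => U a, fun a => V a,
    countable_univ_iff.1 (hUI.countable_univ fun a => a.2), hUI, fun x hx => ?_,
    fun a => ⟨he a, he' a, hUo a, (hK a).of_isClosed_subset isClosed_closure (hcl a),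
      (hcl a).trans (hKe a), hsW a, hmaps a, hVU a⟩⟩
  obtain ⟨a, ha⟩ := mem_iUnion.1 (hAV hx)
  exact mem_iUnion.2 ⟨⟨a, x, hVU a (subset_closure ha)⟩, ha⟩

/-- The leafwise approximation theorem, with the neighbourhood given by constraints. -/
theorem FolMapRS.exists_contMDiff_satisfied {r : ℕ∞} {s : ℕ} (hsr : (s : ℕ∞) ≤ r)
    [HasGroupoid M (foliationGroupoid r q p)] [HasGroupoid M' (foliationGroupoid r q' p')]
    (φ : FolMapRS q p q' p' M M' r s) {E O : Set M} (hE : IsClosed E) (hO : IsOpen O)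
    (hEO : E ⊆ O) (hφ : ContMDiffOn 𝓘(ℝ, FolModel q p) 𝓘(ℝ, FolModel q' p') r φ.toFun O)
    {ι : Type*} {C : ι → PlaqueConstraint q p q' p' M M' s}
    (hC : LocallyFinite fun i => (C i).K) (hφC : ∀ i, (C i).Satisfied φ.toFun) :
    ∃ ψ : FolMapRS q p q' p' M M' r s, (∀ i, (C i).Satisfied ψ.toFun) ∧
      ContMDiff 𝓘(ℝ, FolModel q p) 𝓘(ℝ, FolModel q' p') r ψ.toFun ∧
      ∃ O' : Set M, IsOpen O' ∧ E ⊆ O' ∧ EqOn ψ.toFun φ.toFun O' := by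
  have : LocallyCompactSpace M := ChartedSpace.locallyCompactSpace (FolModel q p) M
  have : HasGroupoid M' (foliationGroupoid 0 q' p') :=
    hasGroupoid_foliationGroupoid_of_le (k' := r) zero_le
  -- The charts will cover the complement of `O` and avoid the closure of `O₁`, so that nothing
  -- changes on `O₁`.
  obtain ⟨O₁, hO₁, hEO₁, hO₁O⟩ := normal_exists_closure_subset hE hO hEO
  obtain ⟨I, e, e', U, V, hI, hU, hOV, hcov⟩ := exists_countable_foliation_cover
    (q := q) (p := p) (q' := q') (p' := p') r
    φ.contMDiff.continuous hO.isClosed_compl isClosed_closure.isOpen_compl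
    (compl_subset_compl.2 hO₁O)
  choose he he' hUo hUc hUe heW hmaps hVU using hcov
  -- These constraints keep each intermediate map in the chart `e' a` and in the plaques of `φ` over
  -- `U a`. Only the plaque conditions matter; the tolerance `1` is arbitrary.
  let B : I → PlaqueConstraint q p q' p' M M' s := fun a =>
    ⟨φ.toFun, e a, e' a, closure (U a), 1, φ.contMDiff, (he a).of_le hsr, (he' a).of_le hsr, hUc a,
      hUe a, (hmaps a).mono_left (hUe a)⟩
  let CB : ι ⊕ I → PlaqueConstraint q p q' p' M M' s := Sum.elim C B
  have hCB : LocallyFinite fun i => (CB i).K := by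
    convert hC.sumElim hU.closure using 1
    ext (i | i) <;> rfl
  have hφCB : ∀ i, (CB i).Satisfied φ.toFun := by
    rintro (i | a)
    · exact hφC i
    · exact fun x hx => ⟨hmaps a (hUe a hx), rfl, fun j _ => by simp [CB, B]⟩
  obtain ⟨F, hFφ, hF⟩ := hU.exists_successive_modification (V := V)
    (P := fun g => ContMDiff 𝓘(ℝ, FolModel q p) 𝓘(ℝ, FolModel q' p') s g ∧
      ∀ i, (CB i).Satisfied g)
    (D := fun g x => ContMDiffAt 𝓘(ℝ, FolModel q p) 𝓘(ℝ, FolModel q' p') r g x)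
    (fun a g hg => by
      have hga : ∀ x ∈ U a, g x ∈ (e' a).source ∧ (e' a (g x)).1 = (e' a (φ.toFun x)).1 :=
        fun x hx =>
          have h := hg.2 (Sum.inr a) x (subset_closure hx)
          ⟨h.1, h.2.1⟩
      obtain ⟨g', h₁, h₂, h₃⟩ := exists_leafwise_smoothing hsr hCB (he a) (he' a) (hUo a) (hUc a)
        (hUe a) (hVU a) hg.1 hg.2 (fun x hx => (hga x hx).1)
        -- By the constraint `B a`, the transverse component of `g` on `U a` is that of `φ`, hence
        -- `C^r`.
        (((φ.transverse _ _ (he a) (he' a) (hmaps a)).mono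
          (subset_closure.trans (hUe a))).congr fun x hx => (hga x hx).2)
      exact ⟨g', ⟨h₁, h₂⟩, h₃⟩) ⟨φ.contMDiff, hφCB⟩
  have hFr : ContMDiff 𝓘(ℝ, FolModel q p) 𝓘(ℝ, FolModel q' p') r F := by
    intro x
    obtain ⟨g, -, hg, h₁, h₂⟩ := hF x
    refine ContMDiffAt.congr_of_eventuallyEq ?_ hg
    by_cases hx : x ∈ O
    · exact h₁ (hφ.contMDiffAt (hO.mem_nhds hx))
    · exact h₂ (hOV hx)
  have hFC : ∀ i, (CB i).Satisfied F := fun i x hx => by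
    obtain ⟨g, hgP, hg, -⟩ := hF x
    exact (hgP.2 i x hx).congr hx hg
  have hleaf : ∀ x, leaf q' p' (F x) = leaf q' p' (φ.toFun x) := by
    intro x
    by_cases hx : x ∈ ⋃ a, U a
    · obtain ⟨a, ha⟩ := mem_iUnion.1 hx
      have h := hFC (Sum.inr a) x (subset_closure ha)
      exact ((he' a).of_le zero_le).leaf_eq_of_fst_eq h.1
        (hmaps a (hUe a (subset_closure ha))) h.2.1
    · rw [hFφ hx]
  refine ⟨⟨⟨F, fun x y hy => ?_, hFr.of_le (by exact_mod_cast hsr)⟩, fun a a' ha ha' hm => ?_⟩,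
    fun i => hFC (Sum.inl i), hFr, O₁, hO₁, hEO₁, fun x hx => hFφ ?_⟩
  · have h₁ := φ.mapsTo_leaf x hy
    rw [hleaf x]
    have h₂ : F y ∈ leaf q' p' (F y) := @mem_connectedComponent _ (leafTopology q' p' M') _
    rw [hleaf y] at h₂
    have h₃ : leaf q' p' (φ.toFun y) = leaf q' p' (φ.toFun x) :=
      (@connectedComponent_eq _ (leafTopology q' p' M') _ _ h₁).symm
    rwa [h₃] at h₂
  · intro x hx
    have h₁ := (ha'.contMDiffAt (hm hx)).comp x (hFr x)
    exact (ContMDiffAt.comp x (contDiff_fst.contMDiff.contMDiffAt) h₁).contMDiffWithinAt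
  · rintro ⟨_, ⟨a, rfl⟩, hxa⟩
    exact heW a (hUe a (subset_closure hxa)) (subset_closure hx)

end Approximation

theorem mainTheorem5 {q p q' p' : ℕ} {M M' : Type*}
    [TopologicalSpace M] [T2Space M] [SecondCountableTopology M] [ChartedSpace (FolModel q p) M]
    [TopologicalSpace M'] [T2Space M'] [SecondCountableTopology M']
    [ChartedSpace (FolModel q' p') M']
    (r : ℕ∞) (s : ℕ) (hsr : (s : ℕ∞) < r)
    [HasGroupoid M (foliationGroupoid r q p)] [HasGroupoid M' (foliationGroupoid r q' p')] :
    (∀ (φ : FolMapRS q p q' p' M M' r s) (E : Set M), IsClosed E →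
      (∃ O : Set M, IsOpen O ∧ E ⊆ O ∧
        ContMDiffOn 𝓘(ℝ, FolModel q p) 𝓘(ℝ, FolModel q' p') r φ.toFun O) →
      ∀ N ∈ 𝓝 φ, ∃ ψ ∈ N,
        ContMDiff 𝓘(ℝ, FolModel q p) 𝓘(ℝ, FolModel q' p') r ψ.toFun ∧
        ∃ O : Set M, IsOpen O ∧ E ⊆ O ∧ EqOn ψ.toFun φ.toFun O) ∧
    Dense {ψ : FolMapRS q p q' p' M M' r s |
      ContMDiff 𝓘(ℝ, FolModel q p) 𝓘(ℝ, FolModel q' p') r ψ.toFun} := by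
  have main : ∀ (φ : FolMapRS q p q' p' M M' r s) (E : Set M), IsClosed E →
      (∃ O : Set M, IsOpen O ∧ E ⊆ O ∧
        ContMDiffOn 𝓘(ℝ, FolModel q p) 𝓘(ℝ, FolModel q' p') r φ.toFun O) →
      ∀ N ∈ 𝓝 φ, ∃ ψ ∈ N,
        ContMDiff 𝓘(ℝ, FolModel q p) 𝓘(ℝ, FolModel q' p') r ψ.toFun ∧
        ∃ O : Set M, IsOpen O ∧ E ⊆ O ∧ EqOn ψ.toFun φ.toFun O := by
    rintro φ E hE ⟨O, hO, hEO, hφ⟩ N hN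
    rw [nhds_induced] at hN
    obtain ⟨N', hN', hNN'⟩ := hN
    obtain ⟨ι, C, hC, hφC, hCN⟩ := exists_constraints_of_mem_nhds hN'
    obtain ⟨ψ, hψC, hψ, hψE⟩ := φ.exists_contMDiff_satisfied hsr.le hE hO hEO hφ hC hφC
    exact ⟨ψ, hNN' (hCN _ hψC), hψ, hψE⟩
  refine ⟨main, fun φ => mem_closure_iff_nhds.2 fun N hN => ?_⟩
  obtain ⟨ψ, hψN, hψ, -⟩ := main φ ∅ isClosed_empty
    ⟨∅, isOpen_empty, Subset.rfl, fun x hx => hx.elim⟩ N hN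
  exact ⟨ψ, hψN, hψ⟩
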